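/- A multigraph on $[n]=\{1,\dots,n\}$ is a function $w:\binom{[n]}{2}\to\{0,1,2,\dots\}$. For integers $s\ge 2$, $q\ge 0$ let $F(n,s,q)$ be the set of multigraphs $G=([n],w)$ such that $\sum_{xy\in\binom X2}w(xy)\le q$ for every $X\subseteq[n]$ with $|X|=s$. Put $P(G)=\prod_{xy\in\binom{[n]}2}w(xy)$, and for $n\ge s$ let $\mathrm{ex}_\Pi(n,s,q)=\max\{P(G):G\in F(n,s,q)\}$ and $\mathcal P(n,s,q)=\{G\in F(n,s,q):P(G)=\mathrm{ex}_\Pi(n,s,q)\}$. Let $\mathrm{ex}_\Pi(s,q)=\lim_{n\to\infty}\mathrm{ex}_\Pi(n,s,q)^{1/\binom n2}$. Let $\mathbb U_a(n)$ be the multigraph on $[n]$ with all multiplicities equal to $a$. For $k\ge1$ let $\mathbb U_{k,a}(n)$ be the set of multigraphs $([n],w)$ for which there is a partition $[n]=A_0\cup A_1\cup\dots\cup A_{\lfloor n/k\rfloor}$ with $|A_i|=k$ for $i\ge1$ and $|A_0|=n-k\lfloor n/k\rfloor$ (possibly $A_0=\emptyset$) such that, inside each nonempty $A_i$, the pairs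 of multiplicity $a+1$ are the $|A_i|-1$ edges of a spanning star of $A_i$, and all other pairs of vertices of $[n]$ have multiplicity $a$. Two multigraphs on $[n]$ are $\delta$-close if their multiplicities differ on at most $\delta n^2$ pairs. **Theorem.** Let $s,q,a,b$ be integers with $s\ge2$, $a\ge1$, $0\le b\le s-2$ and $q=a\binom s2+b$. * (Extremal) For all $n\ge s$, $$a^{\binom n2}\le \mathrm{ex}_\Pi(n,s,q)\le a^{\binom n2}\Big(\frac{a+1}a\Big)^{\lfloor \frac{b}{b+1}n\rfloor},$$ and the limit $\mathrm{ex}_\Pi(s,q)$ exists and equals $a$. Further, for all $n\ge s$: (a) if $b=0$, then $\mathcal P(n,s,q)=\{\mathbb U_a(n)\}$ and $\mathrm{ex}_\Pi(n,s,q)=a^{\binom n2}$; (b) if $b=s-2$, then $\mathbb U_{s-1,a}(n)\subseteq\mathcal P(n,s,q)$ and $\mathrm{ex}_\Pi(n,s,q)=a^{\binom n2}\big(\frac{a+1}a\big)^{\lfloor (s-2)n/(s-1)\rfloor}$; if moreover $s=3$, then $\mathcal P(n,3,q)=\mathbb U_{2,a}(n)$. * (Stability) For all $\delta>0$ there are $\epsilon>0$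 and $M$ such that for all $n>M$ and all $G\in F(n,s,q)$, if $P(G)>\mathrm{ex}_\Pi(n,s,q)^{1-\epsilon}$, then $G$ is $\delta$-close to $\mathbb U_a(n)$. -/

import Mathlib

namespace WeightedPairs

/-- `Pair V` is the set of unordered pairs of distinct elements of `V`. -/
abbrev Pair (V : Type) : Type := {e : Sym2 V // ¬ e.IsDiag}

/-- A multigraph with vertex set `V`: every unordered pair of distinct vertices gets a
multiplicity in `ℕ = {0, 1, 2, …}`. -/
abbrev Multigraph (V : Type) : Type := Pair V → ℕ

section finite

variable {V : Type} [Fintype V] [DecidableEq V]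

/-- The pairs of distinct vertices that lie inside `X`. -/
def pairsIn (X : Finset V) : Finset (Pair V) :=
  Finset.univ.filter (fun e => e.1 ∈ X.sym2)

/-- Every set of `s` vertices spans at most `q` edges, counted with multiplicity. -/
def IsSQGraph (s q : ℕ) (G : Multigraph V) : Prop :=
  ∀ X : Finset V, X.card = s → ∑ e ∈ pairsIn X, G e ≤ q

/-- The product `P(G)` of all the multiplicities. -/
def edgeProd (G : Multigraph V) : ℕ := ∏ e, G e

/-- The set `Δ(G, G')` of the pairs on which two multigraphs differ. -/
def diffPairs (G G' : Multigraph V) : Finset (Pair V) :=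
  Finset.univ.filter (fun e => G e ≠ G' e)

/-- `G` and `G'` are `δ`-close: they differ on at most `δ |V|²` pairs. -/
def IsClose (δ : ℝ) (G G' : Multigraph V) : Prop :=
  ((diffPairs G G').card : ℝ) ≤ δ * (Fintype.card V : ℝ) ^ 2

/-- Inside `A`, the pairs of multiplicity `a + 1` are the `|A| - 1` edges of a spanning star of `A`
(with centre `c`), and all other pairs have multiplicity `a`.  No condition if `A` is empty. -/
def IsStarOn (a : ℕ) (G : Multigraph V) (A : Finset V) : Prop :=
  A.Nonempty → ∃ c ∈ A, ∀ e ∈ pairsIn A, G e = if c ∈ e.1 then a + 1 else a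

end finite

/-- `F(n, s, q)`: the `(s, q)`-graphs with vertex set `[n]`. -/
def graphsF (n s q : ℕ) : Set (Multigraph (Fin n)) := {G | IsSQGraph s q G}

/-- `ex_Π(n, s, q)`, the largest value of `P(G)` over `F(n, s, q)`
(for `n ≥ s ≥ 2` it is attained: see `isGreatest_exProd`). -/
noncomputable def exProd (n s q : ℕ) : ℕ := sSup (edgeProd '' graphsF n s q)

/-- The set of the product-extremal `(s, q)`-graphs with vertex set `[n]`. -/
def prodExtremal (n s q : ℕ) : Set (Multigraph (Fin n)) :=
  {G | G ∈ graphsF n s q ∧ edgeProd G = exProd n s q}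

/-- The asymptotic product density `lim_{n → ∞} ex_Π(n, s, q) ^ (1 / (n choose 2))` exists and
equals `L`. -/
def HasProdDensity (s q : ℕ) (L : ℝ) : Prop :=
  Filter.Tendsto (fun n : ℕ => (exProd n s q : ℝ) ^ (1 / (n.choose 2 : ℝ)))
    Filter.atTop (nhds L)

/-- The constant multigraph `𝕌_a(n)`. -/
def constGraph (n a : ℕ) : Multigraph (Fin n) := fun _ => a

/-- `𝕌_{k,a}(n)`: the vertex set is partitioned into `⌊n/k⌋` parts of size `k` and one
(possibly empty) remainder part `A 0`; each part carries a spanning star of multiplicity `a + 1`,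
and all pairs that are not in one of these stars have multiplicity `a`. -/
def starBlocks (n k a : ℕ) : Set (Multigraph (Fin n)) :=
  {G | ∃ A : Fin (n / k + 1) → Finset (Fin n),
      (∀ i j, i ≠ j → Disjoint (A i) (A j)) ∧
      (∀ v, ∃ i, v ∈ A i) ∧
      (∀ i, i ≠ 0 → (A i).card = k) ∧
      (A 0).card = n - k * (n / k) ∧
      (∀ i, IsStarOn a G (A i)) ∧
      (∀ e, (∀ i, e ∉ pairsIn (A i)) → G e = a)}

theorem isGreatest_exProd {n s q : ℕ} (hs : 2 ≤ s) (hn : s ≤ n) :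
    IsGreatest (edgeProd '' graphsF n s q) (exProd n s q) := by
  have hb : BddAbove (edgeProd '' graphsF n s q) := by
    refine ⟨q ^ Fintype.card (Pair (Fin n)), ?_⟩
    rintro _ ⟨G, hG, rfl⟩
    refine Finset.prod_le_pow_card _ _ _ fun e _ => ?_
    obtain ⟨X, hX, hXs⟩ := Finset.exists_superset_card_eq (s := e.1.toFinset) (n := s)
      (by rw [Sym2.card_toFinset_of_not_isDiag _ e.2]; exact hs) (by simpa using hn)
    refine le_trans ?_ (hG X hXs)
    refine Finset.single_le_sum (f := G) (fun _ _ => Nat.zero_le _) ?_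
    simp only [pairsIn, Finset.mem_filter, Finset.mem_univ, true_and, Finset.mem_sym2_iff]
    exact fun v hv => hX (Sym2.mem_toFinset.2 hv)
  have hne : (edgeProd '' graphsF n s q).Nonempty :=
    ⟨_, (fun _ => 0 : Multigraph (Fin n)), fun X _ => by simp, rfl⟩
  exact ⟨Nat.sSup_mem hne hb, fun _ h => le_csSup hb h⟩

end WeightedPairs

/-!
Write `d = w - a` for the signed excess of the multiplicities over `a`, so that every `s`-set has
total excess at most `b`. Averaging over the sets obtained by deleting one vertex shows that an
`m`-set with `m ≥ s` has excess at most `b + m - s`. For large sets this is improved to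
`b m / (b + 1)` by taking a maximal set `Y` with fewer than `s` vertices and excess at least
`min (|Y| - 1) (b + 1)`: by maximality no vertex outside `Y` adds to the excess of `Y`, so either
`Y` splits off and induction applies, or every outside vertex loses at least one.

The step to products is a Bernoulli inequality, `w ≤ a ((a + 1) / a) ^ (w - a)` for every natural
number `w`, with equality exactly for `w = a` and `w = a + 1`. Thus `P(G)` is at most
`a ^ (n choose 2)` times `(a + 1) / a` to the power of the total excess. Equality forces all
multiplicities to be `a` or `a + 1`, which yields the extremal structure, and every multiplicity
below `a` costs a fixed factor `exp (-1 / a ^ 2)`, which yields stability.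
-/

namespace WeightedPairs

open Finset

section Weight

variable {V : Type} [Fintype V] [DecidableEq V] {X Y Z : Finset V} {e : Pair V}

lemma mem_pairsIn : e ∈ pairsIn X ↔ ∀ v ∈ e.1, v ∈ X := by
  simp [pairsIn, mem_sym2_iff]

lemma pairsIn_univ : pairsIn (univ : Finset V) = univ := by
  ext e
  simp [mem_pairsIn]

lemma pairsIn_mono (h : X ⊆ Y) : pairsIn X ⊆ pairsIn Y :=
  fun _ he => mem_pairsIn.2 fun v hv => h (mem_pairsIn.1 he v hv)

lemma pairsIn_erase (X : Finset V) (v : V) : pairsIn (X.erase v) = {e ∈ pairsIn X | v ∉ e.1} := by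
  ext e
  simp only [mem_filter, mem_pairsIn, mem_erase]
  grind

lemma pairsIn_inter (X Y : Finset V) : pairsIn (X ∩ Y) = pairsIn X ∩ pairsIn Y := by
  ext e
  simp only [mem_inter, mem_pairsIn]
  grind

lemma disjoint_pairsIn (h : Disjoint X Y) : Disjoint (pairsIn X) (pairsIn Y) := by
  rw [Finset.disjoint_left] at h ⊢
  intro e heX heY
  exact h (mem_pairsIn.1 heX _ e.1.out_fst_mem) (mem_pairsIn.1 heY _ e.1.out_fst_mem)

lemma card_pairsIn (X : Finset V) : #(pairsIn X) = (#X).choose 2 := by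
  rw [← Sym2.card_image_offDiag, ← card_map (Function.Embedding.subtype _)]
  congr 1
  ext e
  induction e with
  | _ x y => simp [mem_pairsIn]; grind

lemma card_pair_univ : Fintype.card (Pair V) = (Fintype.card V).choose 2 :=
  Sym2.card_subtype_not_diag

/-- The pairs with one vertex in `Y` and the other in `Z`. -/
def crossPairs (Y Z : Finset V) : Finset (Pair V) := {e | ∃ y ∈ Y, ∃ z ∈ Z, e.1 = s(y, z)}

lemma mem_crossPairs : e ∈ crossPairs Y Z ↔ ∃ y ∈ Y, ∃ z ∈ Z, e.1 = s(y, z) := by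
  simp [crossPairs]

lemma pairsIn_union (Y Z : Finset V) :
    pairsIn (Y ∪ Z) = pairsIn Y ∪ pairsIn Z ∪ crossPairs Y Z := by
  ext ⟨e, he⟩
  induction e with
  | _ x y =>
    simp only [mem_union, mem_pairsIn, mem_crossPairs, Sym2.mem_iff, Sym2.eq_iff]
    grind

lemma disjoint_pairsIn_crossPairs (h : Disjoint Y Z) :
    Disjoint (pairsIn Y ∪ pairsIn Z) (crossPairs Y Z) := by
  rw [Finset.disjoint_left] at h ⊢
  rintro ⟨e, he⟩ hin hcross
  obtain ⟨y, hy, z, hz, rfl⟩ := mem_crossPairs.1 hcross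
  simp only [mem_union, mem_pairsIn, Sym2.mem_iff] at hin
  grind

lemma crossPairs_eq_biUnion (Y Z : Finset V) :
    crossPairs Y Z = Z.biUnion fun z => crossPairs Y {z} := by
  ext e
  simp only [mem_crossPairs, mem_biUnion, mem_singleton]
  grind

lemma pairwiseDisjoint_crossPairs (h : Disjoint Y Z) :
    (Z : Set V).PairwiseDisjoint fun z => crossPairs Y {z} := by
  rw [Finset.disjoint_left] at h
  intro z hz z' hz' hne
  refine Finset.disjoint_left.2 fun e he he' => ?_
  simp only [mem_crossPairs, mem_singleton] at he he'
  obtain ⟨y, hy, _, rfl, hyz⟩ := he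
  obtain ⟨_, -, _, rfl, hyz'⟩ := he'
  rw [hyz, Sym2.eq_iff] at hyz'
  grind

/-- The total weight of the pairs inside `X`. -/
def weight {M : Type*} [AddCommMonoid M] (d : Pair V → M) (X : Finset V) : M :=
  ∑ e ∈ pairsIn X, d e

lemma weight_univ {M : Type*} [AddCommMonoid M] (d : Pair V → M) :
    weight d univ = ∑ e, d e := by
  rw [weight, pairsIn_univ]

lemma weight_singleton {M : Type*} [AddCommMonoid M] (d : Pair V → M) (v : V) :
    weight d {v} = 0 := by
  rw [weight, card_eq_zero.1 (card_pairsIn {v}), sum_empty]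

lemma weight_union_eq_add_crossPairs {M : Type*} [AddCommMonoid M] (d : Pair V → M)
    (h : Disjoint Y Z) :
    weight d (Y ∪ Z) = weight d Y + weight d Z + ∑ e ∈ crossPairs Y Z, d e := by
  simp only [weight]
  rw [pairsIn_union, sum_union (disjoint_pairsIn_crossPairs h), sum_union (disjoint_pairsIn h)]

lemma weight_insert {M : Type*} [AddCommMonoid M] (d : Pair V → M) {v : V} (hv : v ∉ Y) :
    weight d (insert v Y) = weight d Y + ∑ e ∈ crossPairs Y {v}, d e := by
  rw [insert_eq, union_comm, weight_union_eq_add_crossPairs d (disjoint_singleton_right.2 hv),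
    weight_singleton, add_zero]

lemma weight_union {M : Type*} [AddCommGroup M] (d : Pair V → M) (h : Disjoint Y Z) :
    weight d (Y ∪ Z) =
      weight d Y + weight d Z + ∑ z ∈ Z, (weight d (insert z Y) - weight d Y) := by
  rw [weight_union_eq_add_crossPairs d h, crossPairs_eq_biUnion,
    sum_biUnion (pairwiseDisjoint_crossPairs h)]
  congr 1
  refine sum_congr rfl fun z hz => ?_
  rw [weight_insert d (Finset.disjoint_right.1 h hz), add_sub_cancel_left]

lemma weight_eq_sum_inter {M ι : Type*} [AddCommMonoid M] [Fintype ι] {d : Pair V → M}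
    {A : ι → Finset V} (hA : Pairwise (Function.onFun Disjoint A))
    (hd : ∀ e, (∀ i, e ∉ pairsIn (A i)) → d e = 0) (X : Finset V) :
    weight d X = ∑ i, weight d (X ∩ A i) := by
  have hdisj : ∀ i ∈ univ, ∀ j ∈ univ, i ≠ j →
      Disjoint (pairsIn (X ∩ A i)) (pairsIn (X ∩ A j)) := fun i _ j _ hij =>
    disjoint_pairsIn ((hA hij).mono inter_subset_right inter_subset_right)
  simp only [weight]
  rw [← sum_biUnion hdisj]
  refine (sum_subset (biUnion_subset.2 fun i _ => pairsIn_mono inter_subset_left)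
    fun e he hne => hd e fun i hi => hne ?_).symm
  exact mem_biUnion.2 ⟨i, mem_univ i, by rw [pairsIn_inter]; exact mem_inter.2 ⟨he, hi⟩⟩

lemma sum_weight_erase {R : Type*} [Ring R] (d : Pair V → R) (X : Finset V) :
    ∑ v ∈ X, weight d (X.erase v) = (#X - 2) * weight d X := by
  simp only [weight, pairsIn_erase, sum_filter]
  rw [sum_comm, mul_sum]
  refine sum_congr rfl fun e he => ?_
  have hsub : e.1.toFinset ⊆ X := fun v hv => mem_pairsIn.1 he v (Sym2.mem_toFinset.1 hv)
  have hcard : #e.1.toFinset = 2 := Sym2.card_toFinset_of_not_isDiag _ e.2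
  have hfilter : {v ∈ X | v ∉ e.1} = X \ e.1.toFinset := by
    ext v
    simp [Sym2.mem_toFinset]
  rw [← sum_filter, sum_const, hfilter, card_sdiff_of_subset hsub, nsmul_eq_mul,
    Nat.cast_sub (card_le_card hsub), hcard, Nat.cast_two]

lemma mul_weight_le_of_forall_erase_le {R : Type*} [Ring R] [PartialOrder R] [IsOrderedRing R]
    {d : Pair V → R} {c : R} (h : ∀ v ∈ X, weight d (X.erase v) ≤ c) :
    (#X - 2) * weight d X ≤ #X * c := by
  rw [← sum_weight_erase, ← nsmul_eq_mul]
  exact sum_le_card_nsmul X _ c h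

lemma weight_le_of_forall_insert_le {R : Type*} [Ring R] [PartialOrder R] [IsOrderedRing R]
    {d : Pair V → R} (hYX : Y ⊆ X) {c : R} (h : ∀ v ∈ X \ Y, weight d (insert v Y) ≤ c) :
    weight d X ≤ weight d Y + weight d (X \ Y) + #(X \ Y) * (c - weight d Y) := by
  conv_lhs => rw [← union_sdiff_of_subset hYX, weight_union d disjoint_sdiff]
  rw [← nsmul_eq_mul]
  gcongr
  exact sum_le_card_nsmul _ _ _ fun v hv => sub_le_sub_right (h v hv) _

end Weight

section SparseWeight

variable {V : Type} [Fintype V] [DecidableEq V] {d : Pair V → ℤ} {s b : ℕ} {X : Finset V}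

lemma weight_nonpos (hs : 2 ≤ s) (hd : ∀ Y ⊆ X, #Y = s → weight d Y ≤ 0) (hX : s ≤ #X) :
    weight d X ≤ 0 := by
  induction hm : #X - s generalizing X with
  | zero => exact hd X subset_rfl (by omega)
  | succ m ih =>
    have herase : ∀ v ∈ X, weight d (X.erase v) ≤ 0 := fun v hv => by
      have hcard := card_erase_of_mem hv
      exact ih (fun Y hY => hd Y (hY.trans (erase_subset v X))) (by omega) (by omega)
    have haverage := mul_weight_le_of_forall_erase_le herase
    rw [mul_zero] at haverage
    exact nonpos_of_mul_nonpos_right haverage (by omega)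

lemma weight_le_add_card_sub (hb : b + 2 ≤ s) (hd : ∀ Y ⊆ X, #Y = s → weight d Y ≤ b)
    (hX : s ≤ #X) : weight d X ≤ b + #X - s := by
  induction hm : #X - s generalizing X with
  | zero =>
    have := hd X subset_rfl (by omega)
    omega
  | succ m ih =>
    have herase : ∀ v ∈ X, weight d (X.erase v) ≤ b + #X - 1 - s := fun v hv => by
      have hcard := card_erase_of_mem hv
      have := ih (fun Y hY => hd Y (hY.trans (erase_subset v X))) (by omega) (by omega)
      omega
    have haverage := mul_weight_le_of_forall_erase_le herase
    -- A weight of at least `b + #X - s + 1` would violate the averaged bound, as `b + 2 ≤ s`.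
    by_contra! hlt
    have hpos : (0 : ℤ) < #X - 2 := by omega
    nlinarith [mul_le_mul_of_nonneg_left hlt hpos.le]

lemma mul_weight_le_of_card_le (hb : b + 2 ≤ s) (hd : ∀ Y ⊆ X, #Y = s → weight d Y ≤ b)
    (hX : s ≤ #X) (hcard : #X ≤ (s - b) * (b + 1)) : (b + 1) * weight d X ≤ b * #X := by
  have hweight := weight_le_add_card_sub hb hd hX
  have hcard' : (#X : ℤ) ≤ (s - b) * (b + 1) := by
    rw [← Nat.cast_sub (by omega)]
    exact_mod_cast hcard
  nlinarith

lemma exists_maximal_heavy_subset (hb : b + 2 ≤ s) (hd : ∀ Y ⊆ X, #Y = s → weight d Y ≤ b)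
    (hX : X.Nonempty) :
    ∃ Y ⊆ X, Y.Nonempty ∧ #Y < s ∧ min (#Y - 1 : ℤ) (b + 1) ≤ weight d Y ∧
      ∀ v ∈ X \ Y, weight d (insert v Y) ≤ min (#Y - 1 : ℤ) b := by
  obtain ⟨x, hx⟩ := hX
  have hsingleton : {x} ∈ {Y ∈ X.powerset | #Y ≤ s ∧ min (#Y - 1 : ℤ) (b + 1) ≤ weight d Y} := by
    simp only [mem_filter, mem_powerset, singleton_subset_iff, card_singleton, weight_singleton]
    exact ⟨hx, by omega⟩
  obtain ⟨Y, hYmem, hYmax⟩ := exists_max_image _ card ⟨_, hsingleton⟩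
  have hYpos := hYmax _ hsingleton
  simp only [mem_filter, mem_powerset, card_singleton] at hYmem hYmax hYpos
  obtain ⟨hYX, hYs, hYheavy⟩ := hYmem
  have hYlt : #Y < s := lt_of_le_of_ne hYs fun h => by
    have := hd Y hYX h
    omega
  refine ⟨Y, hYX, card_pos.1 hYpos, hYlt, hYheavy, fun v hv => ?_⟩
  rw [mem_sdiff] at hv
  have hcard := card_insert_of_notMem hv.2
  by_contra! hlt
  have := hYmax (insert v Y) ⟨insert_subset hv.1 hYX, by omega, by omega⟩
  omega

/-- The additive bound of Füredi and Kündgen on the number of edges of a multigraph. -/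
theorem mul_weight_le (hb : b + 2 ≤ s) (hd : ∀ Y ⊆ X, #Y = s → weight d Y ≤ b) (hX : s ≤ #X) :
    (b + 1) * weight d X ≤ b * #X := by
  rcases Nat.eq_zero_or_pos b with rfl | hb0
  · simpa using weight_nonpos hb (by simpa using hd) hX
  induction X using Finset.strongInduction with
  | H X ih =>
  by_cases hsmall : #X ≤ (s - b) * (b + 1)
  · exact mul_weight_le_of_card_le hb hd hX hsmall
  have hlarge : 2 * s - 1 ≤ #X := by
    obtain ⟨t, rfl⟩ := Nat.exists_eq_add_of_le hb
    rw [show b + 2 + t - b = t + 2 by omega] at hsmall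
    have : t ≤ t * b := Nat.le_mul_of_pos_right t hb0
    grind
  obtain ⟨Y, hYX, hYne, hYs, hYheavy, hinsert⟩ :=
    exists_maximal_heavy_subset hb hd (card_pos.1 (by omega))
  have hYpos := hYne.card_pos
  have hcard : (#(X \ Y) : ℤ) = #X - #Y := by
    have := card_sdiff_add_card_eq_card hYX
    omega
  have hd' : ∀ Z ⊆ X \ Y, #Z = s → weight d Z ≤ b := fun Z hZ => hd Z (hZ.trans sdiff_subset)
  have hsplit := weight_le_of_forall_insert_le hYX hinsert
  rcases le_or_gt #Y (b + 1) with hYb | hYb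
  · -- The vertices outside `Y` contribute nothing towards `Y`: split `Y` off.
    have hrest := ih (X \ Y) (sdiff_ssubset hYX hYne) hd' (by omega)
    rw [min_eq_left (by omega)] at hsplit hYheavy
    have hX' : weight d X ≤ #Y - 1 + weight d (X \ Y) := by nlinarith
    nlinarith
  · -- Every vertex outside `Y` loses at least one: the total weight stays below `b`.
    have hrest := weight_le_add_card_sub hb hd' (by omega)
    rw [min_eq_right (by omega)] at hsplit hYheavy
    have hX' : weight d X ≤ b := by nlinarith
    nlinarith

end SparseWeight

section Efficiency

variable {a w : ℕ}

/-- The ratio of the multiplicity `w` to its upper bound `a * ((a + 1) / a) ^ (w - a)`, which is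
geometric in `w` and sharp exactly at `a` and `a + 1`. -/
noncomputable def efficiency (a w : ℕ) : ℝ := w / (a * ((a + 1) / a : ℝ) ^ (w - a : ℤ))

lemma efficiency_nonneg (a w : ℕ) : 0 ≤ efficiency a w := by
  unfold efficiency
  positivity

lemma efficiency_self (ha : 0 < a) : efficiency a a = 1 := by
  rw [efficiency, sub_self, zpow_zero, mul_one, div_self (by positivity)]

lemma efficiency_succ_sub (ha : 0 < a) (w : ℕ) :
    efficiency a (w + 1) - efficiency a w =
      (a - w) / ((a + 1) * a * ((a + 1) / a : ℝ) ^ (w - a : ℤ)) := by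
  have hr : ((a + 1) / a : ℝ) ≠ 0 := by positivity
  rw [efficiency, efficiency, Nat.cast_succ w, Nat.cast_succ w, add_sub_right_comm,
    zpow_add_one₀ hr]
  field_simp
  ring

lemma efficiency_succ_self (ha : 0 < a) : efficiency a (a + 1) = 1 := by
  have h := efficiency_succ_sub ha a
  rwa [sub_self, zero_div, sub_eq_zero, efficiency_self ha] at h

lemma strictMonoOn_efficiency (ha : 0 < a) : StrictMonoOn (efficiency a) (Set.Iic a) := by
  refine strictMonoOn_of_lt_succ Set.ordConnected_Iic fun w _ _ hw => ?_
  have hwa : (w : ℝ) < a := by exact_mod_cast hw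
  rw [Nat.succ_eq_succ, ← sub_pos, efficiency_succ_sub ha]
  exact div_pos (sub_pos.2 hwa) (by positivity)

lemma strictAntiOn_efficiency (ha : 0 < a) :
    StrictAntiOn (efficiency a) (Set.Ici (a + 1)) := by
  refine strictAntiOn_of_succ_lt Set.ordConnected_Ici fun w _ hw _ => ?_
  have haw : (a : ℝ) < w := by exact_mod_cast hw
  rw [Nat.succ_eq_succ, ← sub_neg, efficiency_succ_sub ha]
  exact div_neg_of_neg_of_pos (sub_neg.2 haw) (by positivity)

lemma efficiency_lt_one (ha : 0 < a) (hw : w ≠ a) (hw' : w ≠ a + 1) : efficiency a w < 1 := by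
  rcases lt_or_gt_of_ne hw with hlt | hgt
  · rw [← efficiency_self ha]
    exact strictMonoOn_efficiency ha hlt.le (le_refl a) hlt
  · rw [← efficiency_succ_self ha]
    have hgt' : a + 1 < w := by omega
    exact strictAntiOn_efficiency ha (le_refl (a + 1)) hgt'.le hgt'

lemma efficiency_eq_one_iff (ha : 0 < a) : efficiency a w = 1 ↔ w = a ∨ w = a + 1 := by
  constructor
  · contrapose!
    exact fun h => (efficiency_lt_one ha h.1 h.2).ne
  · rintro (rfl | rfl)
    exacts [efficiency_self ha, efficiency_succ_self ha]

lemma efficiency_le_one (ha : 0 < a) (w : ℕ) : efficiency a w ≤ 1 := by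
  by_cases h : w = a ∨ w = a + 1
  · exact ((efficiency_eq_one_iff ha).2 h).le
  · push Not at h
    exact (efficiency_lt_one ha h.1 h.2).le

lemma efficiency_le_exp_of_lt (hw : w < a) : efficiency a w ≤ Real.exp (-1 / a ^ 2) := by
  obtain ⟨m, rfl⟩ := Nat.exists_eq_add_one_of_ne_zero (Nat.ne_zero_of_lt hw)
  have hmono : efficiency (m + 1) w ≤ efficiency (m + 1) m :=
    (strictMonoOn_efficiency m.succ_pos).monotoneOn hw.le (Nat.le_succ m) (Nat.lt_succ_iff.1 hw)
  have hgap : efficiency (m + 1) m = -1 / ((m + 1 : ℕ) : ℝ) ^ 2 + 1 := by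
    have h := efficiency_succ_sub m.succ_pos m
    rw [efficiency_self m.succ_pos, show (m : ℤ) - (m + 1 : ℕ) = -1 by omega, zpow_neg_one,
      sub_eq_iff_eq_add] at h
    push_cast at h ⊢
    field_simp at h ⊢
    linarith
  exact hmono.trans (hgap.trans_le (Real.add_one_le_exp _))

end Efficiency

section EdgeProd

lemma prod_zpow_eq_zpow_sum {ι G₀ : Type*} [CommGroupWithZero G₀] {r : G₀} (hr : r ≠ 0)
    (t : Finset ι) (f : ι → ℤ) : ∏ i ∈ t, r ^ f i = r ^ ∑ i ∈ t, f i := by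
  induction t using Finset.cons_induction with
  | empty => simp
  | cons i t hi ih => rw [prod_cons, sum_cons, ih, zpow_add₀ hr]

variable {V : Type} [Fintype V] [DecidableEq V] {a s b : ℕ} {G : Multigraph V}

/-- The signed excess of the multiplicities of `G` over `a`. -/
def excess (a : ℕ) (G : Multigraph V) : Pair V → ℤ := fun e => G e - a

lemma weight_excess (a : ℕ) (G : Multigraph V) (X : Finset V) :
    weight (excess a G) X = (∑ e ∈ pairsIn X, G e : ℕ) - (a * (#X).choose 2 : ℕ) := by
  simp only [weight, excess, sum_sub_distrib, sum_const, card_pairsIn, nsmul_eq_mul]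
  push_cast
  ring

lemma isSQGraph_iff :
    IsSQGraph s (a * s.choose 2 + b) G ↔ ∀ X : Finset V, #X = s → weight (excess a G) X ≤ b := by
  refine forall₂_congr fun X hX => ?_
  rw [weight_excess, hX]
  omega

lemma weight_excess_univ_le (hb : b + 2 ≤ s) (hV : s ≤ Fintype.card V)
    (hG : IsSQGraph s (a * s.choose 2 + b) G) :
    weight (excess a G) univ ≤ (b * Fintype.card V / (b + 1) : ℕ) := by
  have h := mul_weight_le hb (fun X _ => isSQGraph_iff.1 hG X) hV
  rw [card_univ] at h
  push_cast
  rw [Int.le_ediv_iff_mul_le (by omega)]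
  linarith

lemma edgeProd_eq_mul_prod_efficiency (ha : 0 < a) (G : Multigraph V) :
    (edgeProd G : ℝ) = a ^ (Fintype.card V).choose 2 *
      ((a + 1) / a : ℝ) ^ weight (excess a G) univ * ∏ e, efficiency a (G e) := by
  have hr : ((a + 1) / a : ℝ) ≠ 0 := by positivity
  have hzpow : ((a + 1) / a : ℝ) ^ weight (excess a G) univ =
      ∏ e, ((a + 1) / a : ℝ) ^ (G e - a : ℤ) := by
    rw [weight_univ, ← prod_zpow_eq_zpow_sum hr]
    rfl
  rw [edgeProd, Nat.cast_prod, hzpow, ← card_pair_univ, ← card_univ, ← prod_const,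
    ← prod_mul_distrib, ← prod_mul_distrib]
  refine prod_congr rfl fun e _ => (mul_div_cancel₀ _ ?_).symm
  positivity

lemma edgeProd_le (ha : 0 < a) (G : Multigraph V) :
    (edgeProd G : ℝ) ≤ a ^ (Fintype.card V).choose 2 *
      ((a + 1) / a : ℝ) ^ weight (excess a G) univ := by
  rw [edgeProd_eq_mul_prod_efficiency ha]
  exact mul_le_of_le_one_right (by positivity)
    (prod_le_one (fun _ _ => efficiency_nonneg _ _) fun _ _ => efficiency_le_one ha _)

lemma edgeProd_eq_iff (ha : 0 < a) :
    (edgeProd G : ℝ) = a ^ (Fintype.card V).choose 2 *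
      ((a + 1) / a : ℝ) ^ weight (excess a G) univ ↔ ∀ e, G e = a ∨ G e = a + 1 := by
  simp only [← efficiency_eq_one_iff ha]
  rw [edgeProd_eq_mul_prod_efficiency ha, mul_eq_left₀ (by positivity)]
  refine ⟨fun h e => (efficiency_le_one ha _).antisymm ?_, fun h => prod_eq_one fun e _ => h e⟩
  rw [← h, ← mul_prod_erase _ _ (mem_univ e)]
  exact mul_le_of_le_one_right (efficiency_nonneg _ _)
    (prod_le_one (fun _ _ => efficiency_nonneg _ _) fun _ _ => efficiency_le_one ha _)

lemma edgeProd_le_mul_exp (ha : 0 < a) (G : Multigraph V) :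
    (edgeProd G : ℝ) ≤ a ^ (Fintype.card V).choose 2 *
      ((a + 1) / a : ℝ) ^ weight (excess a G) univ * Real.exp (-#{e | G e < a} / a ^ 2) := by
  rw [edgeProd_eq_mul_prod_efficiency ha]
  gcongr
  calc ∏ e, efficiency a (G e)
      ≤ ∏ e, if G e < a then Real.exp (-1 / a ^ 2) else 1 := by
        refine prod_le_prod (fun _ _ => efficiency_nonneg _ _) fun e _ => ?_
        split_ifs with h
        exacts [efficiency_le_exp_of_lt h, efficiency_le_one ha _]
    _ = Real.exp (-#{e | G e < a} / a ^ 2) := by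
        rw [← prod_filter, prod_const, ← Real.exp_nat_mul]
        ring_nf

lemma edgeProd_le_of_isSQGraph (ha : 0 < a) (hb : b + 2 ≤ s) (hV : s ≤ Fintype.card V)
    (hG : IsSQGraph s (a * s.choose 2 + b) G) :
    (edgeProd G : ℝ) ≤ a ^ (Fintype.card V).choose 2 *
      ((a + 1) / a : ℝ) ^ (b * Fintype.card V / (b + 1)) := by
  have hr : (1 : ℝ) ≤ (a + 1) / a := by
    rw [one_le_div (by positivity)]
    linarith
  refine (edgeProd_le ha G).trans (mul_le_mul_of_nonneg_left ?_ (by positivity))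
  rw [← zpow_natCast]
  exact zpow_le_zpow_right₀ hr (weight_excess_univ_le hb hV hG)

lemma isSQGraph_const (a s b : ℕ) : IsSQGraph s (a * s.choose 2 + b) fun _ : Pair V => a :=
  isSQGraph_iff.2 fun X _ => by simp [weight, excess]

lemma weight_and_multiplicity_of_edgeProd_eq (ha : 0 < a) (hb : b + 2 ≤ s)
    (hV : s ≤ Fintype.card V) (hG : IsSQGraph s (a * s.choose 2 + b) G)
    (hP : (edgeProd G : ℝ) = a ^ (Fintype.card V).choose 2 *
      ((a + 1) / a : ℝ) ^ (b * Fintype.card V / (b + 1))) :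
    weight (excess a G) univ = (b * Fintype.card V / (b + 1) : ℕ) ∧
      ∀ e, G e = a ∨ G e = a + 1 := by
  have hr : (1 : ℝ) < (a + 1) / a := by
    rw [one_lt_div (by positivity)]
    linarith
  have hle := edgeProd_le ha G
  rw [hP, mul_le_mul_iff_right₀ (by positivity), ← zpow_natCast,
    zpow_le_zpow_iff_right₀ hr] at hle
  have hweight := (weight_excess_univ_le hb hV hG).antisymm hle
  refine ⟨hweight, (edgeProd_eq_iff ha).1 ?_⟩
  rw [hP, hweight, zpow_natCast]

end EdgeProd

section StarDecomposition

variable {V : Type} {ι : Type*} [Fintype V] [DecidableEq V] {a b : ℕ} {G : Multigraph V}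
  {X B : Finset V} {A : ι → Finset V} {c : V}

lemma card_pairsIn_filter_mem_add_choose (X : Finset V) (v : V) :
    #{e ∈ pairsIn X | v ∈ e.1} + (#(X.erase v)).choose 2 = (#X).choose 2 := by
  rw [← card_pairsIn, pairsIn_erase, card_filter_add_card_filter_not, card_pairsIn]

lemma card_pairsIn_filter_mem (hc : c ∈ X) : #{e ∈ pairsIn X | c ∈ e.1} = #X - 1 := by
  have h := card_pairsIn_filter_mem_add_choose X c
  obtain ⟨m, hm⟩ := Nat.exists_eq_add_one_of_ne_zero (card_ne_zero_of_mem hc)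
  have hchoose : (m + 1).choose 2 = m + m.choose 2 := by
    rw [Nat.choose_succ_succ' m 1, Nat.choose_one_right]
  rw [card_erase_of_mem hc, hm, Nat.add_sub_cancel] at h
  omega

lemma card_pairsIn_filter_mem_le (X : Finset V) (v : V) : #{e ∈ pairsIn X | v ∈ e.1} ≤ #X - 1 := by
  by_cases hv : v ∈ X
  · exact (card_pairsIn_filter_mem hv).le
  · have h := card_pairsIn_filter_mem_add_choose X v
    rw [erase_eq_of_notMem hv] at h
    omega

lemma weight_excess_of_star (hc : ∀ e ∈ pairsIn X, G e = if c ∈ e.1 then a + 1 else a) :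
    weight (excess a G) X = #{e ∈ pairsIn X | c ∈ e.1} := by
  rw [weight, card_filter, Nat.cast_sum]
  refine sum_congr rfl fun e he => ?_
  rw [excess, hc e he]
  split_ifs <;> simp

lemma IsStarOn.weight_inter_le (h : IsStarOn a G B) (X : Finset V) :
    weight (excess a G) (X ∩ B) ≤ (#(X ∩ B) - 1 : ℕ) := by
  rcases B.eq_empty_or_nonempty with rfl | hB
  · simp [weight, pairsIn]
  obtain ⟨c, -, hc⟩ := h hB
  rw [weight_excess_of_star fun e he => hc e (pairsIn_mono inter_subset_right he)]
  exact_mod_cast card_pairsIn_filter_mem_le _ c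

lemma IsStarOn.weight_eq (h : IsStarOn a G B) : weight (excess a G) B = (#B - 1 : ℕ) := by
  rcases B.eq_empty_or_nonempty with rfl | hB
  · simp [weight, pairsIn]
  obtain ⟨c, hcB, hc⟩ := h hB
  rw [weight_excess_of_star hc, card_pairsIn_filter_mem hcB]

/-- The sets `A i` partition the vertices, possibly with empty parts, and `G` consists of spanning
stars of multiplicity `a + 1` of the parts, all other pairs having multiplicity `a`. -/
structure IsStarDecomposition (a : ℕ) (G : Multigraph V) (A : ι → Finset V) : Prop where
  disjoint : Pairwise (Function.onFun Disjoint A)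
  cover : ∀ v, ∃ i, v ∈ A i
  star : ∀ i, IsStarOn a G (A i)
  eq_of_notMem : ∀ e, (∀ i, e ∉ pairsIn (A i)) → G e = a

lemma exists_isStarDecomposition (a : ℕ) (hA : Pairwise (Function.onFun Disjoint A))
    (hcover : ∀ v, ∃ i, v ∈ A i) : ∃ G : Multigraph V, IsStarDecomposition a G A := by
  classical
  choose c hc using fun i (hi : (A i).Nonempty) => hi
  refine ⟨fun e => if ∃ i hi, e ∈ pairsIn (A i) ∧ c i hi ∈ e.1 then a + 1 else a, hA, hcover,
    fun i hi => ⟨c i hi, hc i hi, fun e he => ?_⟩, fun e he => if_neg ?_⟩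
  · refine if_congr ⟨?_, fun h => ⟨i, hi, he, h⟩⟩ rfl rfl
    rintro ⟨j, hj, hej, hcj⟩
    obtain rfl : i = j := hA.eq fun hij => Finset.disjoint_left.1 (disjoint_pairsIn hij) he hej
    exact hcj
  · rintro ⟨i, -, hi, -⟩
    exact he i hi

omit [Fintype V] in
lemma sum_card_inter_sub_one_add [Fintype ι] (hA : Pairwise (Function.onFun Disjoint A))
    (hcover : ∀ v, ∃ i, v ∈ A i) (X : Finset V) :
    ∑ i, (#(X ∩ A i) - 1) + #{i | (X ∩ A i).Nonempty} = #X := by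
  have hX : X = univ.biUnion fun i => X ∩ A i := by
    ext v
    simpa using fun _ => hcover v
  conv_rhs =>
    rw [hX, card_biUnion fun i _ j _ hij =>
      (hA hij).mono inter_subset_right inter_subset_right]
  rw [card_filter, ← sum_add_distrib]
  refine sum_congr rfl fun i _ => ?_
  split_ifs with h
  · exact Nat.sub_add_cancel h.card_pos
  · rw [not_nonempty_iff_eq_empty.1 h, card_empty]

namespace IsStarDecomposition

lemma multiplicity (h : IsStarDecomposition a G A) (e : Pair V) : G e = a ∨ G e = a + 1 := by
  by_cases he : ∃ i, e ∈ pairsIn (A i)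
  · obtain ⟨i, hi⟩ := he
    obtain ⟨c, -, hc⟩ := h.star i ⟨_, mem_pairsIn.1 hi _ e.1.out_fst_mem⟩
    rw [hc e hi]
    split_ifs <;> simp
  · push Not at he
    exact Or.inl (h.eq_of_notMem e he)

lemma weight_eq_sum [Fintype ι] (h : IsStarDecomposition a G A) (X : Finset V) :
    weight (excess a G) X = ∑ i, weight (excess a G) (X ∩ A i) :=
  weight_eq_sum_inter h.disjoint (fun e he => by simp [excess, h.eq_of_notMem e he]) X

lemma weight_add_le [Fintype ι] (h : IsStarDecomposition a G A) (X : Finset V) :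
    weight (excess a G) X + #{i | (X ∩ A i).Nonempty} ≤ #X := by
  have hle := sum_le_sum fun i (_ : i ∈ univ) => (h.star i).weight_inter_le X
  rw [← h.weight_eq_sum, ← Nat.cast_sum] at hle
  have hcard := sum_card_inter_sub_one_add h.disjoint h.cover X
  omega

lemma weight_univ_add [Fintype ι] (h : IsStarDecomposition a G A) :
    weight (excess a G) univ + #{i | (A i).Nonempty} = Fintype.card V := by
  have hcard := sum_card_inter_sub_one_add h.disjoint h.cover univ
  rw [h.weight_eq_sum]
  simp only [univ_inter, (h.star _).weight_eq, card_univ] at hcard ⊢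
  exact_mod_cast hcard

lemma isSQGraph [Finite ι] (h : IsStarDecomposition a G A) (hcard : ∀ i, #(A i) ≤ b + 1) :
    IsSQGraph (b + 2) (a * (b + 2).choose 2 + b) G := by
  cases nonempty_fintype ι
  refine isSQGraph_iff.2 fun X hX => ?_
  have htwo : 1 < #{i | (X ∩ A i).Nonempty} := by
    obtain ⟨v, hv⟩ : X.Nonempty := card_pos.1 (by omega)
    obtain ⟨i, hi⟩ := h.cover v
    have hnot : ¬ X ⊆ A i := fun hXA => by
      have := (card_le_card hXA).trans (hcard i)
      omega
    obtain ⟨w, hw, hwi⟩ := not_subset.1 hnot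
    obtain ⟨j, hj⟩ := h.cover w
    refine one_lt_card.2 ⟨i, ?_, j, ?_, fun hij => hwi (hij ▸ hj)⟩
    · exact mem_filter.2 ⟨mem_univ i, v, mem_inter.2 ⟨hv, hi⟩⟩
    · exact mem_filter.2 ⟨mem_univ j, w, mem_inter.2 ⟨hw, hj⟩⟩
  have hle := h.weight_add_le X
  omega

end IsStarDecomposition

/-- The family `B` together with the complement of its union, which becomes part `0`. -/
def withRemainder {m : ℕ} (B : Fin m → Finset V) : Fin (m + 1) → Finset V :=
  Fin.cons (univ.biUnion B)ᶜ B

section withRemainder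

variable {m k : ℕ} {B : Fin m → Finset V}

lemma pairwise_disjoint_withRemainder (hB : Pairwise (Function.onFun Disjoint B)) :
    Pairwise (Function.onFun Disjoint (withRemainder B)) := by
  have hzero : ∀ i, Disjoint (univ.biUnion B)ᶜ (B i) := fun i =>
    disjoint_compl_left.mono_right (subset_biUnion_of_mem B (mem_univ i))
  intro i j hij
  cases i using Fin.cases with
  | zero =>
    cases j using Fin.cases with
    | zero => exact absurd rfl hij
    | succ j => exact hzero j
  | succ i =>
    cases j using Fin.cases with
    | zero => exact (hzero i).symm
    | succ j => exact hB fun h => hij (congrArg Fin.succ h)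

lemma exists_mem_withRemainder (B : Fin m → Finset V) (v : V) : ∃ i, v ∈ withRemainder B i := by
  by_cases hv : ∃ i, v ∈ B i
  · obtain ⟨i, hi⟩ := hv
    exact ⟨i.succ, hi⟩
  · exact ⟨0, by simpa [withRemainder] using hv⟩

lemma card_withRemainder_zero (hB : Pairwise (Function.onFun Disjoint B)) (hk : ∀ i, #(B i) = k) :
    #(withRemainder B 0) = Fintype.card V - k * m := by
  rw [withRemainder, Fin.cons_zero, card_compl, card_biUnion fun i _ j _ hij => hB hij,
    sum_congr rfl fun i _ => hk i, sum_const, card_univ, Fintype.card_fin, smul_eq_mul, mul_comm]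

end withRemainder

end StarDecomposition

section StarBlocks

variable {n k a b : ℕ} {G : Multigraph (Fin n)}

lemma mem_starBlocks_iff : G ∈ starBlocks n k a ↔ ∃ A : Fin (n / k + 1) → Finset (Fin n),
    IsStarDecomposition a G A ∧ (∀ i ≠ 0, #(A i) = k) ∧ #(A 0) = n - k * (n / k) :=
  ⟨fun ⟨A, hdisj, hcov, hk, h0, hstar, hrest⟩ => ⟨A, ⟨hdisj, hcov, hstar, hrest⟩, hk, h0⟩,
    fun ⟨A, ⟨hdisj, hcov, hstar, hrest⟩, hk, h0⟩ => ⟨A, hdisj, hcov, hk, h0, hstar, hrest⟩⟩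

lemma mem_starBlocks_of_withRemainder {B : Fin (n / k) → Finset (Fin n)}
    (hB : Pairwise (Function.onFun Disjoint B)) (hk : ∀ i, #(B i) = k)
    (hG : IsStarDecomposition a G (withRemainder B)) : G ∈ starBlocks n k a := by
  refine mem_starBlocks_iff.2 ⟨withRemainder B, hG, fun i hi => ?_, ?_⟩
  · obtain ⟨j, rfl⟩ := Fin.exists_succ_eq.2 hi
    exact hk j
  · rw [card_withRemainder_zero hB hk, Fintype.card_fin]

lemma starBlocks_nonempty (n k a : ℕ) : (starBlocks n k a).Nonempty := by
  obtain ⟨f⟩ : Nonempty (Fin (n / k) × Fin k ↪ Fin n) :=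
    Function.Embedding.nonempty_of_card_le (by simpa using Nat.div_mul_le_self n k)
  let B : Fin (n / k) → Finset (Fin n) := fun i => univ.map ((Function.Embedding.sectR i _).trans f)
  have hB : Pairwise (Function.onFun Disjoint B) := fun i j hij => by
    simp only [Function.onFun, B, Finset.disjoint_left, mem_map, mem_univ, true_and]
    rintro _ ⟨x, rfl⟩ ⟨y, hxy⟩
    exact hij (congrArg Prod.fst (f.injective hxy)).symm
  obtain ⟨G, hG⟩ := exists_isStarDecomposition a (pairwise_disjoint_withRemainder hB)
    (exists_mem_withRemainder B)
  exact ⟨G, mem_starBlocks_of_withRemainder hB (fun i => by simp [B]) hG⟩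

lemma isSQGraph_of_mem_starBlocks (hG : G ∈ starBlocks n (b + 1) a) :
    IsSQGraph (b + 2) (a * (b + 2).choose 2 + b) G := by
  obtain ⟨A, hA, hk, h0⟩ := mem_starBlocks_iff.1 hG
  refine hA.isSQGraph fun i => ?_
  rcases eq_or_ne i 0 with rfl | hi
  · rw [h0, ← Nat.mod_eq_sub_mul_div]
    exact (Nat.mod_lt n b.succ_pos).le
  · exact (hk i hi).le

lemma card_nonempty_mul_le {A : Fin (n / k + 1) → Finset (Fin n)} (hk : 0 < k)
    (h0 : #(A 0) = n - k * (n / k)) : k * #{i | (A i).Nonempty} < n + k := by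
  have hle : #{i : Fin (n / k) | (A i.succ).Nonempty} ≤ n / k := by
    simpa using card_filter_le univ fun i : Fin (n / k) => (A i.succ).Nonempty
  have hmul := Nat.mul_le_mul_left k hle
  have hdiv := Nat.mul_div_le n k
  rw [Fin.card_filter_univ_succ]
  split_ifs with hne
  · have := hne.card_pos
    rw [mul_add, mul_one]
    omega
  · omega

lemma weight_excess_of_mem_starBlocks (hn : b + 2 ≤ n) (hG : G ∈ starBlocks n (b + 1) a) :
    weight (excess a G) univ = (b * n / (b + 1) : ℕ) := by
  have hle := weight_excess_univ_le le_rfl (by simpa using hn) (isSQGraph_of_mem_starBlocks hG)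
  rw [Fintype.card_fin] at hle
  refine hle.antisymm ?_
  obtain ⟨A, hA, -, h0⟩ := mem_starBlocks_iff.1 hG
  have hweight := hA.weight_univ_add
  rw [Fintype.card_fin] at hweight
  have hparts := card_nonempty_mul_le b.succ_pos h0
  rw [← Int.lt_add_one_iff]
  push_cast
  rw [Int.ediv_lt_iff_lt_mul (by omega)]
  zify at hparts
  nlinarith

lemma edgeProd_of_mem_starBlocks (ha : 0 < a) (hn : b + 2 ≤ n) (hG : G ∈ starBlocks n (b + 1) a) :
    (edgeProd G : ℝ) = a ^ n.choose 2 * ((a + 1) / a : ℝ) ^ (b * n / (b + 1)) := by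
  obtain ⟨A, hA, -⟩ := mem_starBlocks_iff.1 hG
  rw [(edgeProd_eq_iff ha).2 hA.multiplicity, weight_excess_of_mem_starBlocks hn hG, zpow_natCast,
    Fintype.card_fin]

end StarBlocks

section Matching

variable {V : Type} [Fintype V] [DecidableEq V] {a : ℕ} {G : Multigraph V}

lemma disjoint_toFinset_of_eq_succ (hG : IsSQGraph 3 (a * Nat.choose 3 2 + 1) G)
    (hmult : ∀ e, a ≤ G e) {e f : Pair V} (hef : e ≠ f) (he : G e = a + 1) (hf : G f = a + 1) :
    Disjoint e.1.toFinset f.1.toFinset := by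
  refine Finset.disjoint_left.2 fun v hve hvf => ?_
  obtain ⟨x, hx⟩ := Sym2.mem_iff_exists.1 (Sym2.mem_toFinset.1 hve)
  obtain ⟨y, hy⟩ := Sym2.mem_iff_exists.1 (Sym2.mem_toFinset.1 hvf)
  have hvx : v ≠ x := fun h => e.2 (by rw [hx, h, Sym2.mk_isDiag_iff])
  have hvy : v ≠ y := fun h => f.2 (by rw [hy, h, Sym2.mk_isDiag_iff])
  have hxy : x ≠ y := fun h => hef (Subtype.ext (by rw [hx, hy, h]))
  have hsub : {e, f} ⊆ pairsIn {v, x, y} := by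
    simp [insert_subset_iff, mem_pairsIn, hx, hy]
  have htwo : 2 ≤ weight (excess a G) {v, x, y} :=
    calc (2 : ℤ) = ∑ g ∈ {e, f}, excess a G g := by
          rw [sum_pair hef, excess, excess, he, hf]
          omega
      _ ≤ weight (excess a G) {v, x, y} := sum_le_sum_of_subset_of_nonneg hsub
          fun g _ _ => sub_nonneg.2 (by exact_mod_cast hmult g)
  have hone := isSQGraph_iff.1 hG _ (card_eq_three.2 ⟨v, x, y, hvx, hvy, hxy, rfl⟩)
  omega

lemma isStarOn_toFinset {e : Pair V} (he : G e = a + 1) : IsStarOn a G e.1.toFinset := by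
  rintro ⟨v, hv⟩
  refine ⟨v, hv, fun f hf => ?_⟩
  have hfe : f = e := by
    have hcard : #(pairsIn e.1.toFinset) = 1 := by
      rw [card_pairsIn, Sym2.card_toFinset_of_not_isDiag _ e.2, Nat.choose_self]
    exact card_le_one.1 hcard.le f hf e (mem_pairsIn.2 fun _ => Sym2.mem_toFinset.2)
  rw [hfe, he, if_pos (Sym2.mem_toFinset.1 hv)]

lemma isStarOn_of_card_le_one {A : Finset V} (hA : #A ≤ 1) : IsStarOn a G A := fun ⟨c, hc⟩ => by
  have hempty : pairsIn A = ∅ := by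
    rw [← card_eq_zero, card_pairsIn]
    exact Nat.choose_eq_zero_of_lt (by omega)
  exact ⟨c, hc, by simp [hempty]⟩

lemma weight_excess_univ_eq_card (hmult : ∀ e, G e = a ∨ G e = a + 1) :
    weight (excess a G) univ = #{e | G e = a + 1} := by
  rw [weight_univ, card_filter, Nat.cast_sum]
  refine sum_congr rfl fun e _ => ?_
  rcases hmult e with h | h <;> simp [excess, h]

lemma exists_pairs_isStarDecomposition {m : ℕ} (hm : Fintype.card V ≤ 2 * m + 1)
    (hG : IsSQGraph 3 (a * Nat.choose 3 2 + 1) G) (hmult : ∀ e, G e = a ∨ G e = a + 1)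
    (hweight : weight (excess a G) univ = m) :
    ∃ B : Fin m → Finset V, Pairwise (Function.onFun Disjoint B) ∧ (∀ i, #(B i) = 2) ∧
      IsStarDecomposition a G (withRemainder B) := by
  have hcard : Fintype.card {e // G e = a + 1} = m := by
    rw [Fintype.card_subtype]
    exact_mod_cast (weight_excess_univ_eq_card hmult).symm.trans hweight
  let φ : Fin m ≃ {e // G e = a + 1} := (Fintype.equivFinOfCardEq hcard).symm
  let B : Fin m → Finset V := fun i => (φ i).1.1.toFinset
  have hBcard : ∀ i, #(B i) = 2 := fun i => Sym2.card_toFinset_of_not_isDiag _ (φ i).1.2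
  have hB : Pairwise (Function.onFun Disjoint B) := fun i j hij =>
    disjoint_toFinset_of_eq_succ hG (fun e => by grind)
      (fun h => hij (φ.injective (Subtype.ext h))) (φ i).2 (φ j).2
  have hremainder : IsStarOn a G (withRemainder B 0) := isStarOn_of_card_le_one (by
    rw [card_withRemainder_zero hB hBcard]
    omega)
  refine ⟨B, hB, hBcard, pairwise_disjoint_withRemainder hB, exists_mem_withRemainder B,
    fun i => ?_, fun e he => (hmult e).resolve_right fun h => ?_⟩
  · cases i using Fin.cases with
    | zero => exact hremainder
    | succ i => exact isStarOn_toFinset (φ i).2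
  · obtain ⟨i, hi⟩ := φ.surjective ⟨e, h⟩
    refine he i.succ (mem_pairsIn.2 fun v hv => ?_)
    simpa [withRemainder, B, hi, Sym2.mem_toFinset] using hv

end Matching

section Extremal

variable {n s a b : ℕ} {G : Multigraph (Fin n)}

lemma floor_div_mul_eq (b n : ℕ) : ⌊(b : ℝ) / ((b : ℝ) + 1) * n⌋₊ = b * n / (b + 1) := by
  rw [div_mul_eq_mul_div]
  exact_mod_cast Nat.floor_div_eq_div (K := ℝ) (b * n) (b + 1)

lemma edgeProd_constGraph (n a : ℕ) : edgeProd (constGraph n a) = a ^ n.choose 2 := by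
  simp only [edgeProd, constGraph, prod_const, card_univ, card_pair_univ, Fintype.card_fin]

lemma pow_le_exProd (a b : ℕ) (hs : 2 ≤ s) (hn : s ≤ n) :
    a ^ n.choose 2 ≤ exProd n s (a * s.choose 2 + b) := by
  rw [← edgeProd_constGraph]
  exact (isGreatest_exProd hs hn).2 ⟨_, isSQGraph_const a s b, rfl⟩

lemma exProd_le (ha : 0 < a) (hb : b + 2 ≤ s) (hn : s ≤ n) :
    (exProd n s (a * s.choose 2 + b) : ℝ) ≤
      a ^ n.choose 2 * ((a + 1) / a : ℝ) ^ (b * n / (b + 1)) := by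
  obtain ⟨G, hG, hP⟩ := (isGreatest_exProd (q := a * s.choose 2 + b) (by omega) hn).1
  rw [← hP]
  simpa only [Fintype.card_fin] using edgeProd_le_of_isSQGraph ha hb (by simpa using hn) hG

lemma exProd_eq_pow (ha : 0 < a) (hs : 2 ≤ s) (hn : s ≤ n) :
    exProd n s (a * s.choose 2) = a ^ n.choose 2 := by
  refine le_antisymm ?_ (pow_le_exProd a 0 hs hn)
  have h := exProd_le (b := 0) ha hs hn
  rw [zero_mul, Nat.zero_div, pow_zero, mul_one] at h
  exact_mod_cast h

lemma exProd_eq_of_tight (ha : 0 < a) (hn : b + 2 ≤ n) :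
    (exProd n (b + 2) (a * (b + 2).choose 2 + b) : ℝ) =
      a ^ n.choose 2 * ((a + 1) / a : ℝ) ^ (b * n / (b + 1)) := by
  obtain ⟨G, hG⟩ := starBlocks_nonempty n (b + 1) a
  refine (exProd_le ha le_rfl hn).antisymm ?_
  rw [← edgeProd_of_mem_starBlocks ha hn hG]
  exact_mod_cast (isGreatest_exProd (by omega) hn).2 ⟨G, isSQGraph_of_mem_starBlocks hG, rfl⟩

lemma starBlocks_subset_prodExtremal (ha : 0 < a) (hn : b + 2 ≤ n) :
    starBlocks n (b + 1) a ⊆ prodExtremal n (b + 2) (a * (b + 2).choose 2 + b) := fun G hG => by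
  refine ⟨isSQGraph_of_mem_starBlocks hG, ?_⟩
  exact_mod_cast (edgeProd_of_mem_starBlocks ha hn hG).trans (exProd_eq_of_tight ha hn).symm

lemma prodExtremal_eq_constGraph (ha : 0 < a) (hs : 2 ≤ s) (hn : s ≤ n) :
    prodExtremal n s (a * s.choose 2) = {constGraph n a} := by
  refine Set.eq_singleton_iff_unique_mem.2
    ⟨⟨isSQGraph_const a s 0, by rw [edgeProd_constGraph, exProd_eq_pow ha hs hn]⟩, ?_⟩
  rintro G ⟨hG, hP⟩
  rw [exProd_eq_pow ha hs hn] at hP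
  obtain ⟨hweight, hmult⟩ := weight_and_multiplicity_of_edgeProd_eq (b := 0) ha hs
    (by simpa using hn) hG (by simp [hP])
  rw [weight_excess_univ_eq_card hmult, zero_mul, Nat.zero_div, Nat.cast_inj, card_eq_zero,
    filter_eq_empty_iff] at hweight
  exact funext fun e => (hmult e).resolve_right (hweight (mem_univ e))

lemma prodExtremal_three (ha : 0 < a) (hn : 3 ≤ n) :
    prodExtremal n 3 (a * Nat.choose 3 2 + 1) = starBlocks n 2 a := by
  refine Set.Subset.antisymm ?_ (starBlocks_subset_prodExtremal (b := 1) ha hn)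
  rintro G ⟨hG, hP⟩
  obtain ⟨hweight, hmult⟩ := weight_and_multiplicity_of_edgeProd_eq (b := 1) ha le_rfl
    (by simpa using hn) hG (by rw [hP, exProd_eq_of_tight (b := 1) ha hn, Fintype.card_fin])
  rw [Fintype.card_fin, one_mul] at hweight
  obtain ⟨B, hB, hcard, hstar⟩ := exists_pairs_isStarDecomposition
    (by rw [Fintype.card_fin]; omega) hG hmult hweight
  exact mem_starBlocks_of_withRemainder hB hcard hstar

end Extremal

section Asymptotics

open Filter

variable {s a b : ℕ}

lemma tendsto_div_choose_two :
    Tendsto (fun n : ℕ => (n : ℝ) / (n.choose 2 : ℝ)) atTop (nhds 0) := by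
  refine squeeze_zero' (.of_forall fun n => by positivity) ?_
    (tendsto_const_div_atTop_nhds_zero_nat 4)
  filter_upwards [eventually_ge_atTop 2] with n hn
  have hn' : (2 : ℝ) ≤ n := by exact_mod_cast hn
  rw [Nat.cast_choose_two, div_le_div_iff₀ (by nlinarith) (by linarith)]
  nlinarith

lemma tendsto_mul_rpow_div_choose_two {r : ℝ} (hr : r ≠ 0) (a : ℝ) :
    Tendsto (fun n : ℕ => a * r ^ ((n : ℝ) / n.choose 2)) atTop (nhds a) := by
  simpa using ((Real.continuousAt_const_rpow hr).tendsto.comp tendsto_div_choose_two).const_mul a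

lemma exProd_le_mul_pow {n : ℕ} (ha : 0 < a) (hb : b + 2 ≤ s) (hn : s ≤ n) :
    (exProd n s (a * s.choose 2 + b) : ℝ) ≤ a ^ n.choose 2 * ((a + 1) / a : ℝ) ^ n := by
  refine (exProd_le ha hb hn).trans ?_
  gcongr
  · rw [one_le_div (by positivity)]
    linarith
  · exact Nat.div_le_of_le_mul (Nat.mul_le_mul_right n b.le_succ)

lemma hasProdDensity (ha : 0 < a) (hb : b + 2 ≤ s) :
    HasProdDensity s (a * s.choose 2 + b) a := by
  have hr : (0 : ℝ) < (a + 1) / a := by positivity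
  refine tendsto_of_tendsto_of_tendsto_of_le_of_le' tendsto_const_nhds
    (tendsto_mul_rpow_div_choose_two hr.ne' a) ?_ ?_
  all_goals
    filter_upwards [eventually_ge_atTop s] with n hn
    have hN : n.choose 2 ≠ 0 := (Nat.choose_pos (by omega)).ne'
    have hroot : ((a : ℝ) ^ n.choose 2) ^ (1 / (n.choose 2 : ℝ)) = a := by
      rw [one_div, Real.pow_rpow_inv_natCast (by positivity) hN]
  · have hle : (a : ℝ) ^ n.choose 2 ≤ exProd n s (a * s.choose 2 + b) := by
      exact_mod_cast pow_le_exProd a b (by omega) hn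
    calc (a : ℝ) = ((a : ℝ) ^ n.choose 2) ^ (1 / (n.choose 2 : ℝ)) := hroot.symm
      _ ≤ _ := by gcongr
  · calc (exProd n s (a * s.choose 2 + b) : ℝ) ^ (1 / (n.choose 2 : ℝ))
        ≤ (a ^ n.choose 2 * ((a + 1) / a : ℝ) ^ n) ^ (1 / (n.choose 2 : ℝ)) := by
          gcongr
          exact exProd_le_mul_pow ha hb hn
      _ = a * ((a + 1) / a : ℝ) ^ ((n : ℝ) / n.choose 2) := by
          rw [Real.mul_rpow (by positivity) (by positivity), hroot, ← Real.rpow_natCast _ n,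
            ← Real.rpow_mul hr.le, mul_one_div]

end Asymptotics

section Stability

variable {V : Type} [Fintype V] [DecidableEq V] {a s b : ℕ} {G : Multigraph V} {ε : ℝ}

lemma card_diffPairs_le (a : ℕ) (G : Multigraph V) :
    (#(diffPairs G fun _ => a) : ℤ) ≤
      weight (excess a G) univ + (a + 1) * #{e | G e < a} := by
  rw [weight_univ, diffPairs, card_filter, card_filter, Nat.cast_sum, Nat.cast_sum, mul_sum,
    ← sum_add_distrib]
  refine sum_le_sum fun e _ => ?_
  simp only [excess]
  split_ifs <;> push_cast <;> omega

lemma log_edgeProd_le (ha : 0 < a) (hP : 0 < edgeProd G) :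
    Real.log (edgeProd G) ≤ (Fintype.card V).choose 2 * Real.log a +
      weight (excess a G) univ * Real.log ((a + 1) / a) - #{e | G e < a} / a ^ 2 := by
  have h := Real.log_le_log (by exact_mod_cast hP) (edgeProd_le_mul_exp ha G)
  rwa [Real.log_mul (by positivity) (by positivity), Real.log_mul (by positivity) (by positivity),
    Real.log_pow, Real.log_zpow, Real.log_exp, neg_div, ← sub_eq_add_neg] at h

lemma card_multiplicity_lt_le (ha : 0 < a) (hε : 0 ≤ ε)
    (hweight : weight (excess a G) univ ≤ Fintype.card V)
    (hP : ((a : ℝ) ^ (Fintype.card V).choose 2) ^ (1 - ε) < edgeProd G) :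
    (#{e | G e < a} : ℝ) ≤ a ^ 3 * ε * Fintype.card V ^ 2 + a * Fintype.card V := by
  have hpow : 0 < ((a : ℝ) ^ (Fintype.card V).choose 2) ^ (1 - ε) := by positivity
  have hlower := Real.log_le_log hpow hP.le
  rw [Real.log_rpow (by positivity), Real.log_pow] at hlower
  have hupper := log_edgeProd_le ha (by exact_mod_cast hpow.trans hP)
  have hpairs : ((Fintype.card V).choose 2 : ℝ) * Real.log a ≤ Fintype.card V ^ 2 * a := by
    gcongr
    · exact_mod_cast Nat.choose_le_pow _ _
    · exact Real.log_le_self (by positivity)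
  have hlogr : Real.log ((a + 1) / a) ≤ 1 / a := by
    refine (Real.log_le_sub_one_of_pos (by positivity)).trans_eq ?_
    field_simp
    ring
  have hexcess : weight (excess a G) univ * Real.log ((a + 1) / a) ≤ Fintype.card V * (1 / a) := by
    have hlog0 : 0 ≤ Real.log ((a + 1) / a : ℝ) := Real.log_nonneg (by
      rw [one_le_div (by positivity)]
      linarith)
    gcongr
    exact_mod_cast hweight
  have hcount : (#{e | G e < a} : ℝ) / a ^ 2 ≤
      ε * (Fintype.card V ^ 2 * a) + Fintype.card V * (1 / a) := by
    linarith [mul_le_mul_of_nonneg_left hpairs hε]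
  rw [div_le_iff₀ (by positivity)] at hcount
  refine hcount.trans_eq ?_
  field_simp

lemma isClose_const (ha : 0 < a) (hε : 0 ≤ ε) {δ : ℝ}
    (hδ : 2 * ((a + 1) * a ^ 3) * ε ≤ δ) (hV : 2 * (1 + a * (a + 1)) ≤ δ * Fintype.card V)
    (hweight : weight (excess a G) univ ≤ Fintype.card V)
    (hP : ((a : ℝ) ^ (Fintype.card V).choose 2) ^ (1 - ε) < edgeProd G) :
    IsClose δ G fun _ => a := by
  have hcard := (Int.cast_le (R := ℝ)).2 (card_diffPairs_le a G)
  have hlt := card_multiplicity_lt_le ha hε hweight hP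
  have hweight' := (Int.cast_le (R := ℝ)).2 hweight
  push_cast at hcard hweight'
  calc (#(diffPairs G fun _ => a) : ℝ)
      ≤ Fintype.card V + (a + 1) * (a ^ 3 * ε * Fintype.card V ^ 2 + a * Fintype.card V) := by
        refine hcard.trans ?_
        gcongr
    _ = 2 * ((a + 1) * a ^ 3) * ε / 2 * Fintype.card V ^ 2 +
          2 * (1 + a * (a + 1)) / 2 * Fintype.card V := by ring
    _ ≤ δ / 2 * Fintype.card V ^ 2 + δ * Fintype.card V / 2 * Fintype.card V := by gcongr
    _ = δ * Fintype.card V ^ 2 := by ring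

theorem stability (ha : 0 < a) (hb : b + 2 ≤ s) {δ : ℝ} (hδ : 0 < δ) :
    ∃ ε : ℝ, 0 < ε ∧ ∃ M : ℕ, ∀ n : ℕ, M < n → ∀ G ∈ graphsF n s (a * s.choose 2 + b),
      (exProd n s (a * s.choose 2 + b) : ℝ) ^ (1 - ε) < (edgeProd G : ℝ) →
        IsClose δ G (constGraph n a) := by
  set ε : ℝ := min 1 (δ / (2 * ((a + 1) * a ^ 3)))
  have hε : 0 < ε := lt_min one_pos (by positivity)
  have hεδ : 2 * ((a + 1) * a ^ 3) * ε ≤ δ := by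
    rw [mul_comm, ← le_div_iff₀ (by positivity)]
    exact min_le_right _ _
  obtain ⟨M, hM⟩ := exists_nat_ge (2 * (1 + a * (a + 1)) / δ)
  refine ⟨ε, hε, max M s, fun n hn G hG hP => ?_⟩
  obtain ⟨hMn, hsn⟩ := max_lt_iff.1 hn
  have hweight : weight (excess a G) univ ≤ Fintype.card (Fin n) := by
    refine (weight_excess_univ_le hb (by simpa using hsn.le) hG).trans ?_
    exact_mod_cast Nat.div_le_of_le_mul (Nat.mul_le_mul_right _ b.le_succ)
  have hlarge : 2 * (1 + a * (a + 1)) ≤ δ * Fintype.card (Fin n) := by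
    rw [div_le_iff₀' hδ] at hM
    rw [Fintype.card_fin]
    exact hM.trans (by gcongr)
  refine isClose_const ha hε.le hεδ hlarge hweight (lt_of_le_of_lt ?_ hP)
  rw [Fintype.card_fin]
  refine Real.rpow_le_rpow (by positivity) ?_ (sub_nonneg.2 (min_le_left _ _))
  exact_mod_cast pow_le_exProd a b (by omega) hsn.le

end Stability

end WeightedPairs

theorem theorem2p3 (s q a b : ℕ) (hs : 2 ≤ s) (ha : 1 ≤ a) (hb : b ≤ s - 2)
    (hq : q = a * s.choose 2 + b) :
    -- extremal part
    (∀ n : ℕ, s ≤ n →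
      (a : ℝ) ^ n.choose 2 ≤ (WeightedPairs.exProd n s q : ℝ) ∧
      (WeightedPairs.exProd n s q : ℝ) ≤
        (a : ℝ) ^ n.choose 2 * (((a : ℝ) + 1) / a) ^ ⌊(b : ℝ) / ((b : ℝ) + 1) * n⌋₊ ∧
      (b = 0 →
        WeightedPairs.prodExtremal n s q = {WeightedPairs.constGraph n a} ∧
        WeightedPairs.exProd n s q = a ^ n.choose 2) ∧
      (b = s - 2 →
        WeightedPairs.starBlocks n (s - 1) a ⊆ WeightedPairs.prodExtremal n s q ∧
        (WeightedPairs.exProd n s q : ℝ) =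
          (a : ℝ) ^ n.choose 2 *
            (((a : ℝ) + 1) / a) ^ ⌊((s : ℝ) - 2) * n / ((s : ℝ) - 1)⌋₊ ∧
        (s = 3 →
          WeightedPairs.prodExtremal n 3 q = WeightedPairs.starBlocks n 2 a))) ∧
    -- asymptotic product density
    WeightedPairs.HasProdDensity s q a ∧
    -- stability
    (∀ δ : ℝ, 0 < δ → ∃ ε : ℝ, 0 < ε ∧ ∃ M : ℕ, ∀ n : ℕ, M < n →
      ∀ G ∈ WeightedPairs.graphsF n s q,
        (WeightedPairs.exProd n s q : ℝ) ^ (1 - ε) < (WeightedPairs.edgeProd G : ℝ) →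
        WeightedPairs.IsClose δ G (WeightedPairs.constGraph n a)) := by
  have hb' : b + 2 ≤ s := by omega
  subst hq
  refine ⟨fun n hn => ⟨?_, ?_, ?_, ?_⟩,
    WeightedPairs.hasProdDensity ha hb', fun δ hδ => WeightedPairs.stability ha hb' hδ⟩
  · exact_mod_cast WeightedPairs.pow_le_exProd a b hs hn
  · rw [WeightedPairs.floor_div_mul_eq]
    exact WeightedPairs.exProd_le ha hb' hn
  · rintro rfl
    exact ⟨WeightedPairs.prodExtremal_eq_constGraph ha hs hn, WeightedPairs.exProd_eq_pow ha hs hn⟩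
  · intro hbs
    obtain rfl : s = b + 2 := by omega
    refine ⟨WeightedPairs.starBlocks_subset_prodExtremal ha hn, ?_, fun h3 => ?_⟩
    · rw [WeightedPairs.exProd_eq_of_tight ha hn, ← WeightedPairs.floor_div_mul_eq]
      push_cast
      ring_nf
    · obtain rfl : b = 1 := by omega
      exact WeightedPairs.prodExtremal_three ha hn
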